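/- Let $T$ be a standard Young tableau of size $n\ge 0$ (a filling of the boxes of the Young diagram of a partition of $n$ by $1,2,\ldots,n$, each used once, increasing along rows and down columns), and let $r_j(T)$ be the row containing the entry $j$, rows being numbered $1,2,\ldots$ from the top. Call $T$ a *Richardson tableau* if for each $1\le j\le n$ with $r_j(T)\ge 2$, the largest of the entries smaller than $j$ in row $r_j(T)-1$ is greater than every entry smaller than $j$ lying in or strictly below row $r_j(T)$. For standard tableaux $T$ of size $m$ and $T'$ of size $n$, the *concatenation* $T\circ T'$ is the standard tableau of size $m+n$ obtained by increasing each entry of $T'$ by $m$ and then appending each row of $T'$ to the corresponding row of $T$. A nonempty standard tableau is *prime* if it is not a concatenation of two standard tableaux of strictly smaller size, and a *prime Richardson tableau* is a Richardson tableau that is prime. Let $\ell\ge 2$ and let $\lambda=(\lambda_1,\ldots,\lambda_{\ell-2},1,1)$ be a partition, that is, $\lambda_1\ge\cdots\ge\lambda_{\ell-2}\ge 1$ (for $\ell=2$, $\lambda=(1,1)$). Then the number of prime Richardson tableaux of shape $\lambda$ equals the number of Richardson tableaux of shape $(\lambda_1,\ldots,\lambda_{\ell-2})$ (the empty shape, with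 exactly one Richardson tableau, if $\ell=2$). -/

import Mathlib

/-- A standard Young tableau: a semistandard Young tableau of some shape with `n` cells whose
entries are exactly `1, 2, …, n`. Rows and columns are indexed from `0` (as in Mathlib), entries
from `1`; the entry function vanishes outside of the shape. -/
structure StandardYoungTableau where
  shape : YoungDiagram
  filling : SemistandardYoungTableau shape
  standard : shape.cells.image (fun c => filling c.1 c.2) = Finset.Icc 1 shape.card

namespace StandardYoungTableau

/-- The size of a tableau: its number of cells. -/
def size (T : StandardYoungTableau) : ℕ := T.shape.card

/-- The entry of `T` in row `i` and column `j` (both counted from `0`). -/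
def entry (T : StandardYoungTableau) (i j : ℕ) : ℕ := T.filling i j

theorem ext_entry {T T' : StandardYoungTableau} (hs : T.shape = T'.shape)
    (he : ∀ i j, T.entry i j = T'.entry i j) : T = T' := by
  obtain ⟨μ, F, h⟩ := T
  obtain ⟨ν, F', h'⟩ := T'
  obtain rfl : μ = ν := hs
  obtain rfl : F = F' := SemistandardYoungTableau.ext he
  rfl

theorem entry_mem (T : StandardYoungTableau) {i j : ℕ} (h : (i, j) ∈ T.shape) :
    1 ≤ T.entry i j ∧ T.entry i j ≤ T.size := by
  have h1 : T.entry i j ∈ T.shape.cells.image (fun c => T.filling c.1 c.2) :=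
    Finset.mem_image.2 ⟨(i, j), h, rfl⟩
  rw [T.standard] at h1
  exact Finset.mem_Icc.1 h1

theorem entry_eq_zero (T : StandardYoungTableau) {i j : ℕ} (h : (i, j) ∉ T.shape) :
    T.entry i j = 0 :=
  T.filling.zeros h

/-- There are only finitely many standard Young tableaux of a given shape. -/
theorem finite_shape (μ : YoungDiagram) : {T : StandardYoungTableau | T.shape = μ}.Finite := by
  let f : {T : StandardYoungTableau // T.shape = μ} → (μ.cells → Fin (μ.card + 1)) :=
    fun T c => ⟨T.1.entry c.1.1 c.1.2, by
      obtain ⟨⟨T, hT⟩, ⟨⟨i, j⟩, hc⟩⟩ := T, c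
      subst hT
      exact Nat.lt_succ_of_le (T.entry_mem hc).2⟩
  have hf : Function.Injective f := by
    rintro ⟨T, hT⟩ ⟨T', hT'⟩ h
    apply Subtype.ext
    refine ext_entry (hT.trans hT'.symm) fun i j => ?_
    by_cases hc : (i, j) ∈ μ
    · exact congrArg Fin.val (congrFun h ⟨(i, j), hc⟩)
    · rw [T.entry_eq_zero (by rwa [hT]), T'.entry_eq_zero (by rwa [hT'])]
  exact Set.finite_coe_iff.1 (Finite.of_injective f hf)

/-- The shape obtained by concatenating the corresponding rows of `μ` and `ν`: row `i` has
`μ.rowLen i + ν.rowLen i` cells. -/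
def concatShape (μ ν : YoungDiagram) : YoungDiagram where
  cells := μ.cells ∪ ν.cells.image (fun c => (c.1, μ.rowLen c.1 + c.2))
  isLowerSet := by
    have key : ∀ i j, (i, j) ∈ μ.cells ∪ ν.cells.image (fun c => (c.1, μ.rowLen c.1 + c.2)) ↔
        j < μ.rowLen i + ν.rowLen i := by
      intro i j
      simp only [Finset.mem_union, Finset.mem_image, YoungDiagram.mem_cells, Prod.exists,
        Prod.mk.injEq, YoungDiagram.mem_iff_lt_rowLen]
      constructor
      · rintro (h | ⟨a, b, h, rfl, rfl⟩) <;> omega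
      · intro h
        by_cases hj : j < μ.rowLen i
        · exact Or.inl hj
        · exact Or.inr ⟨i, j - μ.rowLen i, by omega, rfl, by omega⟩
    rintro ⟨i2, j2⟩ ⟨i1, j1⟩ ⟨hi : i1 ≤ i2, hj : j1 ≤ j2⟩ h
    rw [Finset.mem_coe, key] at h ⊢
    have h1 := μ.rowLen_anti i1 i2 hi
    have h2 := ν.rowLen_anti i1 i2 hi
    omega

theorem mem_concatShape {μ ν : YoungDiagram} {i j : ℕ} :
    (i, j) ∈ concatShape μ ν ↔ j < μ.rowLen i + ν.rowLen i := by
  rw [← YoungDiagram.mem_cells]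
  simp only [concatShape, Finset.mem_union, Finset.mem_image, YoungDiagram.mem_cells, Prod.exists,
    Prod.mk.injEq, YoungDiagram.mem_iff_lt_rowLen]
  constructor
  · rintro (h | ⟨a, b, h, rfl, rfl⟩) <;> omega
  · intro h
    by_cases hj : j < μ.rowLen i
    · exact Or.inl hj
    · exact Or.inr ⟨i, j - μ.rowLen i, by omega, rfl, by omega⟩

theorem card_concatShape (μ ν : YoungDiagram) :
    (concatShape μ ν).card = μ.card + ν.card := by
  have hd : Disjoint μ.cells (ν.cells.image (fun c => (c.1, μ.rowLen c.1 + c.2))) := by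
    rw [Finset.disjoint_left]
    rintro ⟨i, j⟩ h h'
    simp only [Finset.mem_image, YoungDiagram.mem_cells, Prod.exists, Prod.mk.injEq,
      YoungDiagram.mem_iff_lt_rowLen] at h h'
    obtain ⟨a, b, -, rfl, rfl⟩ := h'
    omega
  have hi : Function.Injective (fun c : ℕ × ℕ => (c.1, μ.rowLen c.1 + c.2)) := by
    rintro ⟨a, b⟩ ⟨c, d⟩ h
    simp only [Prod.mk.injEq] at h
    obtain ⟨rfl, h⟩ := h
    simpa using h
  change (μ.cells ∪ _).card = _
  rw [Finset.card_union_of_disjoint hd, Finset.card_image_of_injective _ hi]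

/-- The entry function of the concatenation `T ∘ T'`: row `i` consists of row `i` of `T`,
followed by row `i` of `T'` with every entry increased by the size of `T`. -/
def concatEntry (T T' : StandardYoungTableau) (i j : ℕ) : ℕ :=
  if j < T.shape.rowLen i then T.entry i j
  else if j < T.shape.rowLen i + T'.shape.rowLen i then
    T'.entry i (j - T.shape.rowLen i) + T.size
  else 0

/-- The concatenation `T ∘ T'` of two standard Young tableaux. -/
def concat (T T' : StandardYoungTableau) : StandardYoungTableau where
  shape := concatShape T.shape T'.shape
  filling :=
    { entry := concatEntry T T'
      row_weak' := by
        intro i j1 j2 hj h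
        rw [mem_concatShape] at h
        unfold concatEntry
        by_cases h2 : j2 < T.shape.rowLen i
        · rw [if_pos h2, if_pos (hj.trans h2)]
          exact T.filling.row_weak hj (YoungDiagram.mem_iff_lt_rowLen.2 h2)
        · rw [if_neg h2, if_pos h]
          by_cases h1 : j1 < T.shape.rowLen i
          · rw [if_pos h1]
            have := (T.entry_mem (YoungDiagram.mem_iff_lt_rowLen.2 h1)).2
            omega
          · rw [if_neg h1, if_pos (hj.trans h)]
            exact Nat.add_le_add_right (T'.filling.row_weak (by omega)
              (YoungDiagram.mem_iff_lt_rowLen.2 (by omega))) _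
      col_strict' := by
        intro i1 i2 j hi h
        rw [mem_concatShape] at h
        have a1 := T.shape.rowLen_anti i1 i2 hi.le
        have a2 := T'.shape.rowLen_anti i1 i2 hi.le
        unfold concatEntry
        by_cases h2 : j < T.shape.rowLen i2
        · rw [if_pos h2, if_pos (by omega)]
          exact T.filling.col_strict hi (YoungDiagram.mem_iff_lt_rowLen.2 h2)
        · have hm : (i2, j - T.shape.rowLen i2) ∈ T'.shape :=
            YoungDiagram.mem_iff_lt_rowLen.2 (by omega)
          rw [if_neg h2, if_pos h]
          by_cases h1 : j < T.shape.rowLen i1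
          · rw [if_pos h1]
            have b1 := (T.entry_mem (YoungDiagram.mem_iff_lt_rowLen.2 h1)).2
            have b2 := (T'.entry_mem hm).1
            omega
          · rw [if_neg h1, if_pos (by omega)]
            have b1 : T'.entry i1 (j - T.shape.rowLen i1) ≤ T'.entry i1 (j - T.shape.rowLen i2) :=
              T'.filling.row_weak_of_le (by omega) (T'.shape.up_left_mem hi.le le_rfl hm)
            have b2 : T'.entry i1 (j - T.shape.rowLen i2) < T'.entry i2 (j - T.shape.rowLen i2) :=
              T'.filling.col_strict hi hm
            omega
      zeros' := by
        intro i j h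
        rw [mem_concatShape] at h
        unfold concatEntry
        rw [if_neg (by omega), if_neg h] }
  standard := by
    change (concatShape T.shape T'.shape).cells.image (fun c => concatEntry T T' c.1 c.2) = _
    rw [card_concatShape]
    have surj : ∀ (S : StandardYoungTableau) (x : ℕ), 1 ≤ x → x ≤ S.shape.card →
        ∃ i j, j < S.shape.rowLen i ∧ S.entry i j = x := by
      intro S x h1 h2
      have h : x ∈ S.shape.cells.image (fun c => S.filling c.1 c.2) := by
        rw [S.standard]; exact Finset.mem_Icc.2 ⟨h1, h2⟩
      obtain ⟨⟨i, j⟩, hc, hx⟩ := Finset.mem_image.1 h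
      exact ⟨i, j, YoungDiagram.mem_iff_lt_rowLen.1 hc, hx⟩
    ext x
    simp only [Finset.mem_image, Prod.exists, YoungDiagram.mem_cells, mem_concatShape,
      Finset.mem_Icc]
    constructor
    · rintro ⟨i, j, h, rfl⟩
      unfold concatEntry
      by_cases h1 : j < T.shape.rowLen i
      · rw [if_pos h1]
        have := T.entry_mem (YoungDiagram.mem_iff_lt_rowLen.2 h1)
        simp only [size] at this
        omega
      · rw [if_neg h1, if_pos h]
        have := T'.entry_mem (i := i) (j := j - T.shape.rowLen i)
          (YoungDiagram.mem_iff_lt_rowLen.2 (by omega))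
        simp only [size] at this ⊢
        omega
    · rintro ⟨h1, h2⟩
      by_cases hx : x ≤ T.shape.card
      · obtain ⟨i, j, hj, rfl⟩ := surj T x h1 hx
        exact ⟨i, j, by omega, by simp [concatEntry, hj]⟩
      · obtain ⟨i, j, hj, he⟩ := surj T' (x - T.shape.card) (by omega) (by omega)
        refine ⟨i, T.shape.rowLen i + j, by omega, ?_⟩
        unfold concatEntry
        rw [if_neg (by omega), if_pos (by omega), Nat.add_sub_cancel_left, he, size]
        omega

/-- A standard tableau is prime if it is nonempty and is not the concatenation of two smaller
standard tableaux. -/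
def IsPrime (T : StandardYoungTableau) : Prop :=
  0 < T.size ∧ ¬ ∃ T₁ T₂ : StandardYoungTableau,
    T₁.size < T.size ∧ T₂.size < T.size ∧ T = T₁.concat T₂

/-- The Richardson condition: for every entry `x` of `T` that is not in the first row, say in
row `i + 1` (rows counted from `0`), the largest entry in row `i` of the subtableau of the entries
`< x` is greater than all entries of this subtableau in row `i + 1` or below. (The set of
which `M` is the greatest element is never empty: it contains the entry just above `x`.) -/
def IsRichardson (T : StandardYoungTableau) : Prop :=
  ∀ i j : ℕ, (i + 1, j) ∈ T.shape →
    ∃ M : ℕ,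
      IsGreatest {y | ∃ b, (i, b) ∈ T.shape ∧ T.entry i b = y ∧ y < T.entry (i + 1) j} M ∧
      ∀ a b : ℕ, i + 1 ≤ a → (a, b) ∈ T.shape → T.entry a b < T.entry (i + 1) j →
        T.entry a b < M

end StandardYoungTableau

/-! Record a tableau by the word of the rows of its entries 1, 2, …, rows numbered from 0. Tableaux
become Yamanouchi words, concatenation becomes concatenation of words (`word_concat`), and the
Richardson condition says that before each letter `r + 1` the last letter `≥ r` is an `r`
(`isRichardson_word_iff`). The latter condition implies Yamanouchi.

Let `t` be the largest letter of a Richardson word `u`. Cut `u` after its first `t` and let `d t` be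
the last prime factor of the initial part: `u = y d t z`. Send `u` to `d t y (t + 1) z (t + 2)`.
This adds one `t + 1` and one `t + 2` to the content. The image is Richardson because only letters
`< t` stand between `t` and `t + 1`, and only letters `≤ t` between `t + 1` and `t + 2`; it is prime
because `d t` is (`isPrime_primeGlue`). Conversely, the Richardson condition, read backwards from `t
+ 2`, cuts every prime Richardson word of the new content in this way (`exists_primeGlue_eq`). Both
words determine `(y, d, z)`, so the two sets are images of the same set of triples under injective
maps. The case without a letter `t` is checked directly. -/

/-- Words in the natural numbers, which encode standard tableaux: the letter in position `k` is the
row of the entry `k + 1`. -/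
abbrev RowWord := List ℕ

/-! ### Yamanouchi, Richardson and prime words -/

namespace RowWord

/-- Every prefix contains `i` at least as often as `i + 1`. -/
def IsYamanouchi (w : RowWord) : Prop :=
  ∀ k i, (w.take k).count (i + 1) ≤ (w.take k).count i

/-- `w` contains the letter `r`, and all letters after its last occurrence are smaller. -/
def EndsAt (r : ℕ) (w : RowWord) : Prop :=
  ∃ a b, w = a ++ r :: b ∧ ∀ x ∈ b, x < r

/-- Each letter `r + 1` is preceded by an `r` with only letters smaller than `r` in between. -/
def IsRichardson (w : RowWord) : Prop :=
  ∀ a r b, w = a ++ (r + 1) :: b → EndsAt r a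

/-- A nonempty word that does not split into two nonempty Yamanouchi words. -/
def IsPrime (w : RowWord) : Prop :=
  w ≠ [] ∧ ∀ a b, IsYamanouchi a → IsYamanouchi b → w = a ++ b → a = [] ∨ b = []

theorem EndsAt.append_left {r : ℕ} {w : RowWord} (h : EndsAt r w) (v : RowWord) :
    EndsAt r (v ++ w) := by
  obtain ⟨a, b, rfl, hb⟩ := h
  exact ⟨v ++ a, b, by simp, hb⟩

theorem EndsAt.append_right {r : ℕ} {w v : RowWord} (h : EndsAt r w) (hv : ∀ x ∈ v, x < r) :
    EndsAt r (w ++ v) := by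
  obtain ⟨a, b, rfl, hb⟩ := h
  refine ⟨a, b ++ v, by simp, fun x hx => ?_⟩
  rcases List.mem_append.1 hx with h | h
  exacts [hb x h, hv x h]

/-- Were the last `r` inside `v`, the letter `≥ r` of `w` would come after it. -/
theorem EndsAt.of_append {r : ℕ} {v w : RowWord} (h : EndsAt r (v ++ w)) (hw : ∃ x ∈ w, r ≤ x) :
    EndsAt r w := by
  obtain ⟨a, b, e, hb⟩ := h
  obtain ⟨x, hx, hr⟩ := hw
  rcases List.append_eq_append_iff.1 e with ⟨c, rfl, rfl⟩ | ⟨c, rfl, h⟩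
  · exact ⟨c, b, rfl, hb⟩
  · rcases c with _ | ⟨y, c⟩
    · exact ⟨[], b, by simpa using h.symm, hb⟩
    · simp only [List.cons_append, List.cons.injEq] at h
      obtain ⟨rfl, rfl⟩ := h
      exact absurd (hb x (by simp [hx])) (by omega)

theorem isRichardson_nil : IsRichardson [] := by
  intro a r b h
  simp at h

theorem IsRichardson.of_append_left {v w : RowWord} (h : IsRichardson (v ++ w)) :
    IsRichardson v := by
  rintro a r b rfl
  exact h a r (b ++ w) (by simp)

theorem IsRichardson.concat {w : RowWord} {r : ℕ} (h : IsRichardson w)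
    (hr : ∀ s, r = s + 1 → EndsAt s w) : IsRichardson (w ++ [r]) := by
  intro a s b e
  rcases List.eq_nil_or_concat b with rfl | ⟨b, y, rfl⟩
  · have := List.append_inj' e rfl
    obtain ⟨rfl, h2⟩ := this
    exact hr s (by simpa using h2)
  · have e' : w ++ [r] = (a ++ (s + 1) :: b) ++ [y] := by simpa using e
    exact h a s b (List.append_inj' e' rfl).1

theorem IsRichardson.append {v w : RowWord} (hv : IsRichardson v) (hw : IsRichardson w) :
    IsRichardson (v ++ w) := by
  intro a r b e
  rcases List.append_eq_append_iff.1 e with ⟨c, rfl, h⟩ | ⟨c, rfl, h⟩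
  · exact (hw _ _ _ h).append_left v
  -- With `c` empty, `w` would start with `r + 1`, which has no `r` before it.
  · rcases c with _ | ⟨y, c⟩
    · have := hw [] r b (by simpa using h.symm)
      obtain ⟨a', b', h', -⟩ := this
      simp at h'
    · simp only [List.cons_append, List.cons.injEq] at h
      obtain ⟨rfl, rfl⟩ := h
      exact hv a r c rfl

/-- What follows an occurrence of the largest letter is again Richardson. -/
theorem IsRichardson.of_append_cons {v w : RowWord} {t : ℕ} (h : IsRichardson (v ++ t :: w))
    (ht : ∀ x ∈ w, x ≤ t) : IsRichardson w := by
  rintro a r b rfl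
  have h1 : r + 1 ≤ t := ht _ (by simp)
  have h2 : EndsAt r (t :: a) :=
    (h (v ++ t :: a) r b (by simp)).of_append ⟨t, by simp, by omega⟩
  obtain ⟨a', b', e, hb⟩ := h2
  -- The `r` found is not the leading `t`, since `r < t`; so it lies in `a`.
  rcases a' with _ | ⟨y, a'⟩
  · simp at e
    omega
  · simp only [List.cons_append, List.cons.injEq] at e
    exact ⟨a', b', e.2, hb⟩

theorem isYamanouchi_nil : IsYamanouchi [] := by simp [IsYamanouchi]

theorem IsYamanouchi.count_le {w : RowWord} (h : IsYamanouchi w) (i : ℕ) :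
    w.count (i + 1) ≤ w.count i := by
  simpa using h w.length i

theorem IsYamanouchi.of_append_left {v w : RowWord} (h : IsYamanouchi (v ++ w)) :
    IsYamanouchi v := by
  intro k i
  have := h (min k v.length) i
  rwa [List.take_append_of_le_length (by omega), ← List.take_eq_take_min] at this

theorem IsYamanouchi.append {v w : RowWord} (hv : IsYamanouchi v) (hw : IsYamanouchi w) :
    IsYamanouchi (v ++ w) := by
  intro k i
  rw [List.take_append, List.count_append, List.count_append]
  exact Nat.add_le_add (hv k i) (hw _ i)

/-- Induction on prefixes. Before a new `i + 1` the word is `a i b` with no `i + 1` in `b`; the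
inequality for `a` and the extra `i` leave room for one more `i + 1`. -/
theorem IsRichardson.isYamanouchi {w : RowWord} (h : IsRichardson w) : IsYamanouchi w := by
  induction w using List.reverseRecOn with
  | nil => exact isYamanouchi_nil
  | append_singleton w x ih =>
    have hw := ih h.of_append_left
    intro k i
    by_cases hk : k ≤ w.length
    · rw [List.take_append_of_le_length hk]
      exact hw k i
    · rw [List.take_of_length_le (by simp; omega), List.count_append, List.count_append]
      have h0 := hw.count_le i
      by_cases hx : x = i + 1
      · obtain ⟨a, b, rfl, hb⟩ := h w i [] (by rw [hx])
        have h1 := hw.of_append_left.count_le i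
        have h2 : b.count (i + 1) = 0 := List.count_eq_zero.2 fun hm => by
          have := hb _ hm
          omega
        subst hx
        simp [h2]
        omega
      · have : [x].count (i + 1) = 0 := by simp [hx]
        omega

/-- As `w` is Yamanouchi, each `r + 1` in it has an `r` before it within `w`, so the last such `r`
cannot lie in `v`. -/
theorem IsRichardson.of_append_right {v w : RowWord} (h : IsRichardson (v ++ w))
    (hw : IsYamanouchi w) : IsRichardson w := by
  rintro a r b rfl
  refine (h (v ++ a) r b (by simp)).of_append ⟨r, ?_, le_rfl⟩
  have := (hw : IsYamanouchi (a ++ (r + 1) :: b))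
  have h1 : IsYamanouchi (a ++ [r + 1]) := by
    apply IsYamanouchi.of_append_left (w := b)
    simpa using this
  have h2 := h1.count_le r
  simp at h2
  exact List.count_pos_iff.1 (by omega)

theorem IsYamanouchi.exists_eq_append_isPrime {w : RowWord} (h : IsYamanouchi w) (h0 : w ≠ []) :
    ∃ v c, w = v ++ c ∧ IsYamanouchi c ∧ IsPrime c := by
  induction hn : w.length using Nat.strong_induction_on generalizing w with
  | _ n ih =>
  by_cases hp : IsPrime w
  · exact ⟨[], w, rfl, h, hp⟩
  · simp only [IsPrime, not_and, not_forall, not_or] at hp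
    obtain ⟨a, b, ha, hb, rfl, ha0, hb0⟩ := hp h0
    have hl : b.length < n := by
      have := List.length_pos_iff.2 ha0
      simp at hn
      omega
    obtain ⟨v, c, rfl, hc⟩ := ih _ hl hb hb0 rfl
    exact ⟨a ++ v, c, by simp, hc⟩

/-- The largest letter of a prime Richardson word occurs only at its end. -/
theorem IsPrime.lt_of_mem {d : RowWord} {t : ℕ} (hp : IsPrime (d ++ [t]))
    (hr : IsRichardson (d ++ [t])) (hd : ∀ x ∈ d, x ≤ t) : ∀ x ∈ d, x < t := by
  intro x hx
  refine lt_of_le_of_ne (hd x hx) ?_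
  rintro rfl
  -- Cutting after the earlier occurrence leaves two nonempty Richardson words, against primality.
  obtain ⟨a, b, rfl⟩ := List.append_of_mem hx
  have h1 : IsRichardson (a ++ [x]) := by
    apply IsRichardson.of_append_left (w := b ++ [x])
    simpa using hr
  have h2 : IsRichardson (b ++ [x]) := by
    apply IsRichardson.of_append_cons (v := a) (t := x)
    · simpa using hr
    · intro y hy
      rcases List.mem_append.1 hy with h | h
      · exact hd y (by simp [h])
      · simp at h
        omega
  have := hp.2 _ _ h1.isYamanouchi h2.isYamanouchi (by simp)
  simp at this

/-- Both factorizations cut the word at its first `t`. -/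
theorem append_cons_inj_of_notMem {a b a' b' : RowWord} {t : ℕ} (ha : t ∉ a) (ha' : t ∉ a')
    (h : a ++ t :: b = a' ++ t :: b') : a = a' ∧ b = b' := by
  rcases List.append_eq_append_iff.1 h with ⟨c, rfl, e⟩ | ⟨c, rfl, e⟩ <;>
  rcases c with _ | ⟨y, c⟩
  · simpa using e
  · simp only [List.cons_append, List.cons.injEq] at e
    exact absurd (by simp [e.1]) ha'
  · simpa [eq_comm] using e
  · simp only [List.cons_append, List.cons.injEq] at e
    exact absurd (by simp [e.1]) ha

/-! ### The bijection through triples `(y, d, z)` -/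

/-- The data `(y, d, z)` common to the Richardson word `y d t z` with largest letter `t` and the
prime Richardson word `d t y (t + 1) z (t + 2)`. -/
structure IsSplitting (t : ℕ) (s : RowWord × RowWord × RowWord) : Prop where
  lt_left : ∀ x ∈ s.1, x < t
  lt_mid : ∀ x ∈ s.2.1, x < t
  le_right : ∀ x ∈ s.2.2, x ≤ t
  rich_left : IsRichardson s.1
  rich_mid : IsRichardson (s.2.1 ++ [t])
  rich_right : IsRichardson s.2.2
  prime_mid : IsPrime (s.2.1 ++ [t])

def glue (t : ℕ) (s : RowWord × RowWord × RowWord) : RowWord :=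
  (s.1 ++ s.2.1) ++ t :: s.2.2

def primeGlue (t : ℕ) (s : RowWord × RowWord × RowWord) : RowWord :=
  s.2.1 ++ t :: (s.1 ++ (t + 1) :: (s.2.2 ++ [t + 2]))

theorem IsSplitting.isRichardson_glue {t : ℕ} {s : RowWord × RowWord × RowWord}
    (h : IsSplitting t s) : IsRichardson (glue t s) := by
  have := (h.rich_left.append h.rich_mid).append h.rich_right
  simpa [glue] using this

/-- The first `t` fixes `z` and the product `y d`. If one prime suffix `d t` were longer than the
other, it would be a nonempty Richardson word followed by the shorter one, hence not prime. -/
theorem glue_injOn (t : ℕ) : Set.InjOn (glue t) {s | IsSplitting t s} := by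
  have key : ∀ y d y' d' e : RowWord, y ++ d = y' ++ d' → d' = e ++ d →
      IsPrime (d' ++ [t]) → IsRichardson (d ++ [t]) → IsRichardson (d' ++ [t]) → e = [] := by
    rintro y d y' _ e - rfl hp hd hd'
    have he : IsRichardson e := by
      apply IsRichardson.of_append_left (w := d ++ [t])
      simpa using hd'
    simpa using hp.2 e (d ++ [t]) he.isYamanouchi hd.isYamanouchi (by simp)
  rintro ⟨y, d, z⟩ (h : IsSplitting t _) ⟨y', d', z'⟩ (h' : IsSplitting t _) e
  have hn : ∀ {y d z}, IsSplitting t (y, d, z) → t ∉ y ++ d := by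
    intro y d z h hm
    rcases List.mem_append.1 hm with hm | hm
    · exact (h.lt_left t hm).false
    · exact (h.lt_mid t hm).false
  obtain ⟨e1, rfl⟩ := append_cons_inj_of_notMem (hn h) (hn h') e
  rcases List.append_eq_append_iff.1 e1 with ⟨c, rfl, rfl⟩ | ⟨c, rfl, rfl⟩
  · obtain rfl := key _ _ _ _ c e1.symm rfl h.prime_mid h'.rich_mid h.rich_mid
    simp
  · obtain rfl := key _ _ _ _ c e1 rfl h'.prime_mid h.rich_mid h'.rich_mid
    simp

theorem IsRichardson.exists_glue_eq {t : ℕ} {u : RowWord} (h : IsRichardson u) (ht : t ∈ u)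
    (hle : ∀ x ∈ u, x ≤ t) : ∃ s, IsSplitting t s ∧ glue t s = u := by
  obtain ⟨x, z, rfl, hx⟩ := List.eq_append_cons_of_mem ht
  have hxt : IsRichardson (x ++ [t]) := by
    apply IsRichardson.of_append_left (w := z)
    simpa using h
  have hz : IsRichardson z := h.of_append_cons fun y hy => hle y (by simp [hy])
  have hlt : ∀ y ∈ x, y < t := fun y hy =>
    lt_of_le_of_ne (hle y (by simp [hy])) (by rintro rfl; exact hx hy)
  obtain ⟨y, c, e, hc, hp⟩ := hxt.isYamanouchi.exists_eq_append_isPrime (by simp)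
  rcases List.eq_nil_or_concat c with rfl | ⟨d, r, rfl⟩
  · exact absurd rfl hp.1
  rw [List.concat_eq_append, ← List.append_assoc] at e
  obtain ⟨rfl, er⟩ := List.append_inj' e rfl
  obtain rfl : t = r := by simpa using er
  rw [List.concat_eq_append] at hc hp
  rw [List.append_assoc] at hxt
  exact ⟨(y, d, z), ⟨fun a ha => hlt a (by simp [ha]), fun a ha => hlt a (by simp [ha]),
    fun a ha => hle a (by simp [ha]), hxt.of_append_left, hxt.of_append_right hc, hz, hp⟩, rfl⟩

/-- The hypotheses are not bundled as `IsSplitting` because `exists_primeGlue_eq` applies this to a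
suffix of `d t` whose primality is not known. -/
theorem isRichardson_primeGlue {t : ℕ} {y d z : RowWord} (hy : ∀ x ∈ y, x < t)
    (hz : ∀ x ∈ z, x ≤ t) (ry : IsRichardson y) (rd : IsRichardson (d ++ [t]))
    (rz : IsRichardson z) : IsRichardson (primeGlue t (y, d, z)) := by
  have h1 : IsRichardson (d ++ [t] ++ y ++ [t + 1]) := by
    refine (rd.append ry).concat fun s hs => ?_
    obtain rfl : t = s := by omega
    exact ⟨d, y, by simp, hy⟩
  have h2 : IsRichardson (d ++ [t] ++ y ++ [t + 1] ++ z ++ [t + 2]) := by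
    refine (h1.append rz).concat fun s hs => ?_
    obtain rfl : t + 1 = s := by omega
    exact ⟨d ++ [t] ++ y, z, by simp, fun x hx => by have := hz x hx; omega⟩
  simpa [primeGlue] using h2

theorem primeGlue_injOn (t : ℕ) : Set.InjOn (primeGlue t) {s | IsSplitting t s} := by
  rintro ⟨y, d, z⟩ (h : IsSplitting t _) ⟨y', d', z'⟩ (h' : IsSplitting t _) e
  obtain ⟨rfl, e⟩ := append_cons_inj_of_notMem (fun hm => (h.lt_mid t hm).false)
    (fun hm => (h'.lt_mid t hm).false) e
  obtain ⟨rfl, e⟩ := append_cons_inj_of_notMem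
    (fun hm => by have : t + 1 < t := h.lt_left _ hm; omega)
    (fun hm => by have : t + 1 < t := h'.lt_left _ hm; omega) e
  simpa using e

/-- In a factorization `a b`, the nonempty factor `b` contains the final `t + 2`, hence as a
Yamanouchi word also `t + 1`, and a `t` before it. Only one `t` precedes the only `t + 1`, so the
cut lies at or before that `t` and splits the prime word `d t`. -/
theorem IsSplitting.isPrime_primeGlue {t : ℕ} {s : RowWord × RowWord × RowWord}
    (h : IsSplitting t s) : IsPrime (primeGlue t s) := by
  obtain ⟨y, d, z⟩ := s
  refine ⟨by simp [primeGlue], fun a b ha hb e => ?_⟩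
  by_contra! hne
  have hy := h.lt_left
  have hd := h.lt_mid
  have hz := h.le_right
  simp only at hy hd hz
  have hq : t + 2 ∈ b := by
    have : (a ++ b).getLast? = some (t + 2) := by
      rw [← e, show primeGlue t (y, d, z) = (d ++ t :: (y ++ (t + 1) :: z)) ++ [t + 2] by
        simp [primeGlue], List.getLast?_concat]
    rw [List.getLast?_append_of_ne_nil _ hne.2] at this
    exact List.mem_of_getLast? this
  have hp : t + 1 ∈ b := by
    exact List.count_pos_iff.1 ((List.count_pos_iff.2 hq).trans_le (hb.count_le (t + 1)))
  obtain ⟨b1, b2, rfl, hb1⟩ := List.eq_append_cons_of_mem hp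
  have hb' : IsYamanouchi (b1 ++ [t + 1]) := by
    apply IsYamanouchi.of_append_left (w := b2)
    simpa using hb
  have ht : t ∈ b1 := by
    have := hb'.count_le t
    simp at this
    exact List.count_pos_iff.1 (by omega)
  have ha1 : t + 1 ∉ a := by
    intro hm
    have h1 : 2 ≤ (a ++ (b1 ++ (t + 1) :: b2)).count (t + 1) := by
      have := List.count_pos_iff.2 hm
      simp
      omega
    rw [← e] at h1
    have c1 : d.count (t + 1) = 0 := List.count_eq_zero.2 fun hm => by have := hd _ hm; omega
    have c2 : y.count (t + 1) = 0 := List.count_eq_zero.2 fun hm => by have := hy _ hm; omega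
    have c3 : z.count (t + 1) = 0 := List.count_eq_zero.2 fun hm => by have := hz _ hm; omega
    simp [primeGlue, c1, c2, c3] at h1
  have e' : (d ++ t :: y) ++ (t + 1) :: (z ++ [t + 2]) = (a ++ b1) ++ (t + 1) :: b2 := by
    simpa [primeGlue] using e
  have hn : t + 1 ∉ d ++ t :: y := by
    intro hm
    rcases List.mem_append.1 hm with hm | hm
    · have := hd _ hm
      omega
    · rcases List.mem_cons.1 hm with hm | hm
      · omega
      · have := hy _ hm
        omega
  obtain ⟨e1, -⟩ := append_cons_inj_of_notMem hn (by simp [ha1, hb1]) e'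
  obtain ⟨b3, b4, rfl, hb3⟩ := List.eq_append_cons_of_mem ht
  have ht' : t ∉ a := by
    intro hm
    have h1 : 2 ≤ (a ++ (b3 ++ t :: b4)).count t := by
      have := List.count_pos_iff.2 hm
      simp
      omega
    rw [← e1] at h1
    have c1 : d.count t = 0 := List.count_eq_zero.2 fun hm => by have := hd _ hm; omega
    have c2 : y.count t = 0 := List.count_eq_zero.2 fun hm => by have := hy _ hm; omega
    simp [c1, c2] at h1
  rw [← List.append_assoc] at e1
  obtain ⟨rfl, rfl⟩ := append_cons_inj_of_notMem (fun hm => (hd _ hm).false)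
    (by simp [ht', hb3]) e1
  have hb3' : IsYamanouchi (b3 ++ [t]) := by
    apply IsYamanouchi.of_append_left (w := y ++ (t + 1) :: b2)
    simpa using hb
  have := h.prime_mid.2 a (b3 ++ [t]) ha hb3' (by simp)
  simp [hne.1] at this

/-- Nothing follows `t + 2`, by primality; the Richardson condition at `t + 2` locates `t + 1` and
`z`, and at `t + 1` it locates the last `t` before it and `y`. A Yamanouchi factor `a` split off
from `d t` would also split off from the whole word, so `d t` is prime. -/
theorem IsRichardson.exists_primeGlue_eq {t : ℕ} {w : RowWord} (h : IsRichardson w)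
    (hw : IsPrime w) (h1 : w.count (t + 1) = 1) (h2 : w.count (t + 2) = 1)
    (hle : ∀ x ∈ w, x ≤ t + 2) : ∃ s, IsSplitting t s ∧ primeGlue t s = w := by
  obtain ⟨v, s, rfl, hv⟩ := List.eq_append_cons_of_mem
    (List.count_pos_iff.1 (by omega : 0 < w.count (t + 2)))
  have hvq : IsRichardson (v ++ [t + 2]) := by
    apply IsRichardson.of_append_left (w := s)
    simpa using h
  have hs : IsRichardson s := h.of_append_cons fun y hy => hle y (by simp [hy])
  obtain rfl : s = [] := by
    simpa using hw.2 (v ++ [t + 2]) s hvq.isYamanouchi hs.isYamanouchi (by simp)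
  obtain ⟨x, z, rfl, hz⟩ := h v (t + 1) [] rfl
  have hx : ∀ a ∈ x, a ≤ t := by
    intro a ha
    have h3 : a ≠ t + 2 := by rintro rfl; exact hv (by simp [ha])
    have h4 : a ≠ t + 1 := by
      rintro rfl
      have := List.count_pos_iff.2 ha
      simp at h1
      omega
    have := hle a (by simp [ha])
    omega
  have hz' : ∀ a ∈ z, a ≤ t := fun a ha => Nat.le_of_lt_succ (hz a ha)
  have rz : IsRichardson z := by
    apply IsRichardson.of_append_cons (v := x) (t := t + 1) hvq.of_append_left
    intro a ha
    exact (hz a ha).le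
  obtain ⟨d, y, rfl, hy⟩ := h x t (z ++ [t + 2]) (by simp)
  have rx : IsRichardson (d ++ t :: y) := hvq.of_append_left.of_append_left
  have ry : IsRichardson y := rx.of_append_cons fun a ha => (hy a ha).le
  have rd : IsRichardson (d ++ [t]) := by
    apply IsRichardson.of_append_left (w := y)
    simpa using rx
  have pd : IsPrime (d ++ [t]) := by
    refine ⟨by simp, fun a b ha hb e => ?_⟩
    by_contra! hne
    have rb : IsRichardson b := (e ▸ rd).of_append_right hb
    rcases List.eq_nil_or_concat b with rfl | ⟨b, r, rfl⟩
    · exact hne.2 rfl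
    rw [List.concat_eq_append] at rb hb hne e
    rw [← List.append_assoc] at e
    obtain ⟨rfl, er⟩ := List.append_inj' e rfl
    obtain rfl : t = r := by simpa using er
    have := hw.2 a (primeGlue t (y, b, z)) ha
      (isRichardson_primeGlue hy hz' ry rb rz).isYamanouchi (by simp [primeGlue])
    simp [hne.1, primeGlue] at this
  -- Primality also makes the last `t` before `t + 1` the first one.
  have hd : ∀ a ∈ d, a < t := pd.lt_of_mem rd fun a ha => hx a (by simp [ha])
  exact ⟨(y, d, z), ⟨hy, hd, hz', ry, rd, rz, pd⟩, by simp [primeGlue]⟩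

end RowWord

/-! ### The tableau of a Yamanouchi word -/

namespace RowWord

theorem count_take_succ (w : RowWord) (k i : ℕ) :
    (w.take (k + 1)).count i = (w.take k).count i + if w[k]? = some i then 1 else 0 := by
  rw [List.take_add_one, List.count_append]
  rcases h : w[k]? with _ | x
  · simp
  · by_cases hx : x = i <;> simp [hx]

theorem count_take_mono (w : RowWord) (i : ℕ) : Monotone fun k => (w.take k).count i :=
  fun _ _ h => (List.take_sublist_take_left h).count_le i

theorem count_take_le (w : RowWord) (k i : ℕ) : (w.take k).count i ≤ w.count i :=
  (List.take_sublist k w).count_le i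

/-- The position of each letter, read as a cell: its row is the letter, its column is the number of
earlier occurrences of the same letter. -/
def cell (w : RowWord) (k : ℕ) : ℕ × ℕ := (w.getD k 0, (w.take k).count (w.getD k 0))

theorem cell_injOn (w : RowWord) : Set.InjOn w.cell (Finset.range w.length) := by
  have key : ∀ k k', k < w.length → k' < w.length → w.cell k = w.cell k' → ¬ k < k' := by
    intro k k' hk hk' h hlt
    simp only [cell, Prod.mk.injEq] at h
    obtain ⟨h1, h2⟩ := h
    rw [← h1] at h2
    have h3 := count_take_mono w (w.getD k 0) (Nat.succ_le_of_lt hlt)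
    simp only [Nat.succ_eq_add_one, count_take_succ] at h3
    rw [if_pos (by simp [hk])] at h3
    omega
  intro k hk k' hk' h
  simp only [Finset.coe_range, Set.mem_Iio] at hk hk'
  have h1 := key k k' hk hk' h
  have h2 := key k' k hk' hk h.symm
  omega

theorem exists_count_take {w : RowWord} {i j : ℕ} (h : j < w.count i) :
    ∃ k, j < (w.take k).count i :=
  ⟨w.length, by simpa using h⟩

/-- The entry in row `i` and column `j` of the tableau with row word `w`. -/
def entry (w : RowWord) (i j : ℕ) : ℕ :=
  if h : j < w.count i then Nat.find (exists_count_take h) else 0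

/-- Counts in prefixes grow with the prefix, so the shortest prefix with more than `j` letters `i`
governs all of them. This turns the tableau axioms into inequalities between counts. -/
theorem entry_le_iff {w : RowWord} {i j k : ℕ} (h : j < w.count i) :
    w.entry i j ≤ k ↔ j < (w.take k).count i := by
  rw [entry, dif_pos h, Nat.find_le_iff]
  exact ⟨fun ⟨m, hm, hj⟩ => hj.trans_le (count_take_mono w i hm), fun hk => ⟨k, le_rfl, hk⟩⟩

theorem entry_eq_succ_iff {w : RowWord} {i j k : ℕ} (h : j < w.count i) :
    w.entry i j = k + 1 ↔ w[k]? = some i ∧ (w.take k).count i = j := by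
  have h1 := entry_le_iff (k := k) h
  have h2 := entry_le_iff (k := k + 1) h
  rw [count_take_succ] at h2
  by_cases hk : w[k]? = some i
  · simp only [hk, if_true, true_and] at h2 ⊢
    omega
  · simp only [hk, if_false, false_and, iff_false] at h2 ⊢
    omega

theorem entry_pos {w : RowWord} {i j : ℕ} (h : j < w.count i) : 0 < w.entry i j := by
  have := entry_le_iff (k := 0) h
  simp at this
  omega

theorem mem_image_cell {w : RowWord} {i j : ℕ} :
    (i, j) ∈ (Finset.range w.length).image w.cell ↔ j < w.count i := by
  simp only [Finset.mem_image, Finset.mem_range]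
  constructor
  · rintro ⟨k, hk, h⟩
    simp only [cell, Prod.mk.injEq] at h
    obtain ⟨rfl, rfl⟩ := h
    have h1 := count_take_le w (k + 1) (w.getD k 0)
    rw [count_take_succ, if_pos (by simp [hk])] at h1
    omega
  · intro h
    obtain ⟨k, hk⟩ := Nat.exists_eq_add_of_lt (entry_pos h)
    rw [zero_add, entry_eq_succ_iff h] at hk
    obtain ⟨hk, rfl⟩ := hk
    obtain ⟨hl, he⟩ := List.getElem?_eq_some_iff.1 hk
    exact ⟨k, hl, by simp [cell, hk]⟩

theorem IsYamanouchi.antitone_count {w : RowWord} (h : IsYamanouchi w) (k : ℕ) :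
    Antitone fun i => (w.take k).count i :=
  antitone_nat_of_succ_le fun i => h k i

/-- The shape of the tableau with row word `w`. -/
def shape (w : RowWord) (h : IsYamanouchi w) : YoungDiagram where
  cells := (Finset.range w.length).image w.cell
  isLowerSet := by
    rintro ⟨i2, j2⟩ ⟨i1, j1⟩ ⟨hi : i1 ≤ i2, hj : j1 ≤ j2⟩ hm
    rw [Finset.mem_coe, mem_image_cell] at hm ⊢
    have := h.antitone_count w.length hi
    simp only [List.take_length] at this
    omega

theorem mem_shape {w : RowWord} (h : IsYamanouchi w) {i j : ℕ} :
    (i, j) ∈ w.shape h ↔ j < w.count i := mem_image_cell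

theorem card_shape {w : RowWord} (h : IsYamanouchi w) : (w.shape h).card = w.length := by
  change ((Finset.range w.length).image w.cell).card = _
  rw [Finset.card_image_of_injOn w.cell_injOn, Finset.card_range]

/-- The tableau with row word `w`. -/
def tableau (w : RowWord) (h : IsYamanouchi w) : StandardYoungTableau where
  shape := w.shape h
  filling :=
    { entry := w.entry
      row_weak' := by
        intro i j1 j2 hj hm
        rw [mem_shape] at hm
        rw [entry_le_iff (hj.trans hm)]
        exact hj.trans ((entry_le_iff hm).1 le_rfl)
      col_strict' := by
        intro i1 i2 j hi hm
        have h1 := (mem_shape h).1 ((w.shape h).up_left_mem hi.le le_rfl hm)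
        rw [mem_shape] at hm
        obtain ⟨k, hk⟩ := Nat.exists_eq_add_of_lt (entry_pos hm)
        rw [zero_add] at hk
        rw [hk, Nat.lt_succ_iff, entry_le_iff h1]
        have h2 := (entry_le_iff hm).1 hk.le
        have h3 := h.antitone_count (k + 1) hi.le
        have h4 := ((entry_eq_succ_iff hm).1 hk).1
        simp only at h3
        -- Letter number `k` is `i2 ≠ i1`, so row `i1` has reached column `j` already after `k`
        -- letters; this makes the inequality strict.
        rw [count_take_succ w k i1, if_neg (by rw [h4]; simp; omega)] at h3
        omega
      zeros' := by
        intro i j hm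
        rw [mem_shape] at hm
        rw [entry, dif_neg hm] }
  standard := by
    change (w.shape h).cells.image (fun c => w.entry c.1 c.2) = _
    rw [card_shape]
    ext x
    simp only [Finset.mem_image, Prod.exists, YoungDiagram.mem_cells, mem_shape, Finset.mem_Icc]
    constructor
    · rintro ⟨i, j, hm, rfl⟩
      exact ⟨entry_pos hm, by rw [entry_le_iff hm]; simpa using hm⟩
    · rintro ⟨h1, h2⟩
      obtain ⟨k, rfl⟩ := Nat.exists_eq_add_of_le' h1
      have hw : w[k]? = some w[k] := List.getElem?_eq_getElem (by omega)
      have hc := count_take_le w (k + 1) w[k]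
      rw [count_take_succ, if_pos hw] at hc
      exact ⟨w[k], (w.take k).count w[k], by omega, (entry_eq_succ_iff (by omega)).2 ⟨hw, rfl⟩⟩

end RowWord

/-! ### The word of a tableau, and the dictionary -/

namespace StandardYoungTableau

variable {T T' : StandardYoungTableau} {i j i' j' k : ℕ}

/-- The entries form a set with as many elements as there are cells. -/
theorem eq_of_entry_eq (h : (i, j) ∈ T.shape) (h' : (i', j') ∈ T.shape)
    (he : T.entry i j = T.entry i' j') : i = i' ∧ j = j' := by
  have hinj : Set.InjOn (fun c : ℕ × ℕ => T.filling c.1 c.2) T.shape.cells := by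
    rw [← Finset.card_image_iff, T.standard, Nat.card_Icc, Nat.add_sub_cancel]
  simpa using hinj (x₁ := (i, j)) (x₂ := (i', j')) h h' he

theorem exists_entry_eq (T : StandardYoungTableau) (hk : k < T.size) :
    ∃ i j, (i, j) ∈ T.shape ∧ T.entry i j = k + 1 := by
  have h : k + 1 ∈ T.shape.cells.image (fun c => T.filling c.1 c.2) := by
    rw [T.standard]
    exact Finset.mem_Icc.2 ⟨by omega, hk⟩
  obtain ⟨⟨i, j⟩, hc, hx⟩ := Finset.mem_image.1 h
  exact ⟨i, j, hc, hx⟩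

theorem entry_le_entry (h : (i, j') ∈ T.shape) (hj : j ≤ j') : T.entry i j ≤ T.entry i j' :=
  T.filling.row_weak_of_le hj h

/-- The rows of the entries `1, 2, …` of `T`. -/
noncomputable def word (T : StandardYoungTableau) : RowWord :=
  List.ofFn fun k : Fin T.size => (T.exists_entry_eq k.2).choose

theorem length_word (T : StandardYoungTableau) : T.word.length = T.size := by simp [word]

theorem getElem?_word_eq_some :
    T.word[k]? = some i ↔ ∃ j, (i, j) ∈ T.shape ∧ T.entry i j = k + 1 := by
  rw [List.getElem?_eq_some_iff]
  constructor
  · rintro ⟨hk, rfl⟩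
    simp only [word, List.getElem_ofFn]
    exact (T.exists_entry_eq (k := k) (by simpa [word] using hk)).choose_spec
  · rintro ⟨j, hm, he⟩
    have hk : k < T.size := by
      have := (T.entry_mem hm).2
      omega
    refine ⟨by rwa [length_word], ?_⟩
    simp only [word, List.getElem_ofFn]
    obtain ⟨j', hm', he'⟩ := (T.exists_entry_eq hk).choose_spec
    exact (eq_of_entry_eq hm' hm (he'.trans he.symm)).1

/-- The entries `≤ k` of row `i` fill an initial segment of the row, whose length is the count.
Counts thus recover the shape and all entries from the word. -/
theorem lt_count_take_word :
    j < (T.word.take k).count i ↔ (i, j) ∈ T.shape ∧ T.entry i j ≤ k := by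
  induction k generalizing j with
  | zero =>
    simp only [List.take_zero, List.count_nil, Nat.not_lt_zero, false_iff, not_and]
    intro h
    have := (T.entry_mem h).1
    omega
  | succ k ih =>
    rw [RowWord.count_take_succ]
    split_ifs with hw
    · obtain ⟨c, hc, he⟩ := getElem?_word_eq_some.1 hw
      -- The entry `k + 1` stands in the first column of its row not filled by the entries `≤ k`.
      have h1 : c = (T.word.take k).count i := by
        apply le_antisymm
        · by_contra! hlt
          have h2 := entry_le_entry hc hlt.le
          have h3 := T.shape.up_left_mem le_rfl hlt.le hc
          have h4 : T.entry i ((T.word.take k).count i) ≠ k + 1 := by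
            intro h5
            have := (eq_of_entry_eq h3 hc (h5.trans he.symm)).2
            omega
          exact lt_irrefl _ (ih.2 ⟨h3, by omega⟩)
        · by_contra! hlt
          have := (ih.1 hlt).2
          omega
      constructor
      · intro hj
        have hj' : j ≤ c := by omega
        exact ⟨T.shape.up_left_mem le_rfl hj' hc, (entry_le_entry hc hj').trans he.le⟩
      · rintro ⟨hm, hle⟩
        rcases hle.lt_or_eq with hlt | heq
        · have := ih.2 ⟨hm, Nat.le_of_lt_succ hlt⟩
          omega
        · have := (eq_of_entry_eq hm hc (heq.trans he.symm)).2
          omega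
    · rw [add_zero, ih]
      refine and_congr_right fun hm => ⟨fun h => h.trans k.le_succ, fun h => ?_⟩
      refine Nat.le_of_lt_succ (lt_of_le_of_ne h fun h' => hw ?_)
      exact getElem?_word_eq_some.2 ⟨j, hm, h'⟩

theorem count_word (T : StandardYoungTableau) (i : ℕ) : T.word.count i = T.shape.rowLen i := by
  refine eq_of_forall_lt_iff fun j => ?_
  rw [← YoungDiagram.mem_iff_lt_rowLen, ← List.take_length (l := T.word), lt_count_take_word,
    length_word]
  exact and_iff_left_of_imp fun h => (T.entry_mem h).2

theorem isYamanouchi_word (T : StandardYoungTableau) : T.word.IsYamanouchi := by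
  intro k i
  refine le_of_forall_lt fun j hj => ?_
  rw [lt_count_take_word] at hj ⊢
  exact ⟨T.shape.up_left_mem i.le_succ le_rfl hj.1,
    (T.filling.col_strict i.lt_succ_self hj.1).le.trans hj.2⟩

theorem word_injective : Function.Injective word := by
  intro T T' h
  have hs : T.shape = T'.shape := by
    ext ⟨i, j⟩
    rw [YoungDiagram.mem_cells, YoungDiagram.mem_cells, YoungDiagram.mem_iff_lt_rowLen,
      YoungDiagram.mem_iff_lt_rowLen, ← count_word, ← count_word, h]
  refine ext_entry hs fun i j => ?_
  by_cases hm : (i, j) ∈ T.shape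
  · have hm' : (i, j) ∈ T'.shape := hs ▸ hm
    refine eq_of_forall_ge_iff fun k => ?_
    have h1 := lt_count_take_word (T := T) (i := i) (j := j) (k := k)
    have h2 := lt_count_take_word (T := T') (i := i) (j := j) (k := k)
    rw [h] at h1
    simpa [hm, hm'] using h1.symm.trans h2
  · rw [T.entry_eq_zero hm, T'.entry_eq_zero (hs ▸ hm)]

theorem word_tableau {w : RowWord} (h : w.IsYamanouchi) : (w.tableau h).word = w := by
  refine List.ext_getElem? fun k => Option.ext fun i => ?_
  rw [getElem?_word_eq_some]
  constructor
  · rintro ⟨j, hm, he⟩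
    exact ((RowWord.entry_eq_succ_iff ((RowWord.mem_shape h).1 hm)).1 he).1
  · intro hk
    have hc := RowWord.count_take_le w (k + 1) i
    rw [RowWord.count_take_succ, if_pos hk] at hc
    have hc' : (w.take k).count i < w.count i := by omega
    exact ⟨_, (RowWord.mem_shape h).2 hc', (RowWord.entry_eq_succ_iff hc').2 ⟨hk, rfl⟩⟩

theorem word_concat (T T' : StandardYoungTableau) : (T.concat T').word = T.word ++ T'.word := by
  refine List.ext_getElem? fun k => Option.ext fun i => ?_
  rw [getElem?_word_eq_some, List.getElem?_append, length_word]
  have he : ∀ j, (T.concat T').entry i j = concatEntry T T' i j := fun _ => rfl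
  have hm : ∀ j, (i, j) ∈ (T.concat T').shape ↔ j < T.shape.rowLen i + T'.shape.rowLen i :=
    fun _ => mem_concatShape
  simp only [he, hm, concatEntry]
  split_ifs with hk
  · rw [getElem?_word_eq_some]
    refine exists_congr fun j => ?_
    rw [YoungDiagram.mem_iff_lt_rowLen]
    constructor
    · rintro ⟨h, h'⟩
      split_ifs at h' with h1
      · exact ⟨h1, h'⟩
      · have := (T'.entry_mem (i := i) (j := j - T.shape.rowLen i)
          (YoungDiagram.mem_iff_lt_rowLen.2 (by omega))).1
        omega
    · rintro ⟨h, h'⟩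
      exact ⟨by omega, by rwa [if_pos h]⟩
  · rw [getElem?_word_eq_some]
    constructor
    · rintro ⟨j, h, h'⟩
      split_ifs at h' with h1
      · have := (T.entry_mem (YoungDiagram.mem_iff_lt_rowLen.2 h1)).2
        omega
      · exact ⟨j - T.shape.rowLen i, YoungDiagram.mem_iff_lt_rowLen.2 (by omega), by omega⟩
    · rintro ⟨j, h, h'⟩
      rw [YoungDiagram.mem_iff_lt_rowLen] at h
      refine ⟨T.shape.rowLen i + j, by omega, ?_⟩
      rw [if_neg (by omega), if_pos (by omega), Nat.add_sub_cancel_left]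
      omega

theorem isPrime_word_iff : T.word.IsPrime ↔ T.IsPrime := by
  have h0 : ∀ T : StandardYoungTableau, T.word ≠ [] ↔ 0 < T.size := by
    intro T
    rw [← length_word, List.length_pos_iff]
  have hsize : ∀ T₁ T₂ : StandardYoungTableau, (T₁.concat T₂).size = T₁.size + T₂.size :=
    fun T₁ T₂ => card_concatShape _ _
  refine and_congr (h0 T) ⟨?_, ?_⟩
  · rintro h ⟨T₁, T₂, h1, h2, rfl⟩
    rw [hsize] at h1 h2
    have h1' := (h0 T₁).2 (by omega)
    have h2' := (h0 T₂).2 (by omega)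
    have := h _ _ T₁.isYamanouchi_word T₂.isYamanouchi_word (word_concat _ _)
    tauto
  · intro h a b ha hb e
    by_contra! hne
    have e' : T = (a.tableau ha).concat (b.tableau hb) := by
      apply word_injective
      rw [word_concat, word_tableau, word_tableau, e]
    refine h ⟨_, _, ?_, ?_, e'⟩ <;>
    · rw [← length_word, ← length_word, word_tableau, e]
      have h1 := List.length_pos_iff.2 hne.1
      have h2 := List.length_pos_iff.2 hne.2
      simp
      omega

theorem isRichardson_word_iff : T.word.IsRichardson ↔ T.IsRichardson := by
  constructor
  · intro h i j hm
    obtain ⟨k, hk⟩ := Nat.exists_eq_add_of_le' (T.entry_mem hm).1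
    have hw := getElem?_word_eq_some.2 ⟨j, hm, hk⟩
    obtain ⟨hl, hw'⟩ := List.getElem?_eq_some_iff.1 hw
    have e : T.word = T.word.take k ++ (i + 1) :: T.word.drop (k + 1) := by
      rw [← hw', ← List.drop_eq_getElem_cons, List.take_append_drop]
    obtain ⟨a, b, e1, hb⟩ := h _ _ _ e
    have hlen : a.length + 1 + b.length = k := by
      have := congrArg List.length e1
      simp at this
      omega
    have ha : T.word[a.length]? = some i := by
      rw [e, e1]
      simp
    obtain ⟨c, hc, hce⟩ := getElem?_word_eq_some.1 ha
    -- A larger entry below `T.entry (i + 1) j` would be a letter of `b`, hence in a row above `i`.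
    -- Position `a.length` holds entry `a.length + 1`, which is therefore the required `M`.
    have hlt : ∀ i' j', i ≤ i' → (i', j') ∈ T.shape → T.entry i' j' < T.entry (i + 1) j →
        T.entry i' j' ≤ a.length + 1 := by
      intro i' j' hi hm' hlt
      by_contra! hgt
      obtain ⟨l, hl'⟩ := Nat.exists_eq_add_of_lt hgt
      have hb' : b[l]? = some i' := by
        have h1 := getElem?_word_eq_some.2
          ⟨j', hm', (by omega : T.entry i' j' = (a.length + 1 + l) + 1)⟩
        rw [e, e1, List.append_assoc, List.getElem?_append_right (by omega),
          show a.length + 1 + l - a.length = l + 1 by omega, List.cons_append,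
          List.getElem?_cons_succ, List.getElem?_append_left (by omega)] at h1
        exact h1
      have := hb i' (List.mem_of_getElem? hb')
      omega
    refine ⟨a.length + 1, ⟨⟨c, hc, hce, by omega⟩, ?_⟩, ?_⟩
    · rintro _ ⟨c', hc', rfl, hlt'⟩
      exact hlt i c' le_rfl hc' hlt'
    · intro i' j' hi hm' hlt'
      refine lt_of_le_of_ne (hlt i' j' (by omega) hm' hlt') fun heq => ?_
      have := (eq_of_entry_eq hm' hc (heq.trans hce.symm)).1
      omega
  · intro h a i b e
    have hw : T.word[a.length]? = some (i + 1) := by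
      rw [e]
      simp
    obtain ⟨j, hm, hj⟩ := getElem?_word_eq_some.1 hw
    obtain ⟨M, ⟨⟨c, hc, rfl, hlt⟩, hub⟩, hM⟩ := h i j hm
    obtain ⟨k, hk⟩ := Nat.exists_eq_add_of_le' (T.entry_mem hc).1
    have hka : k < a.length := by omega
    have hwk := getElem?_word_eq_some.2 ⟨c, hc, hk⟩
    rw [e, List.getElem?_append_left hka] at hwk
    obtain ⟨_, hwk'⟩ := List.getElem?_eq_some_iff.1 hwk
    refine ⟨a.take k, a.drop (k + 1), ?_, fun x hx => ?_⟩
    · rw [← hwk', ← List.drop_eq_getElem_cons, List.take_append_drop]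
    · obtain ⟨l, hl⟩ := List.mem_iff_getElem?.1 hx
      rw [List.getElem?_drop] at hl
      have hla : k + 1 + l < a.length := (List.getElem?_eq_some_iff.1 hl).1
      have hwl : T.word[k + 1 + l]? = some x := by
        rw [e, List.getElem?_append_left hla, hl]
      obtain ⟨c', hc', he'⟩ := getElem?_word_eq_some.1 hwl
      by_contra! hx'
      -- A later `i` contradicts the maximality of the entry chosen in row `i`; a later letter `> i`
      -- contradicts the bound on the lower rows.
      rcases hx'.eq_or_lt with rfl | hx'
      · have := hub ⟨c', hc', he', by omega⟩
        omega
      · have := hM x c' hx' hc' (by omega)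
        omega

/-- Passing to row words turns the tableaux of shape `μ` into the Yamanouchi words of content
`μ`. -/
theorem image_word (μ : YoungDiagram) (p : RowWord → Prop)
    (hp : ∀ w, p w → w.IsYamanouchi) :
    word '' {T | T.shape = μ ∧ p T.word} = {w | (∀ i, w.count i = μ.rowLen i) ∧ p w} := by
  ext w
  constructor
  · rintro ⟨T, ⟨rfl, hT⟩, rfl⟩
    exact ⟨T.count_word, hT⟩
  · rintro ⟨hc, hw⟩
    refine ⟨w.tableau (hp w hw), ⟨?_, by rwa [word_tableau]⟩, word_tableau _⟩
    ext ⟨i, j⟩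
    rw [YoungDiagram.mem_cells, YoungDiagram.mem_cells, YoungDiagram.mem_iff_lt_rowLen (μ := μ),
      ← hc]
    exact RowWord.mem_shape (hp w hw)

theorem ncard_shape_eq (μ : YoungDiagram) (p : RowWord → Prop)
    (hp : ∀ w, p w → w.IsYamanouchi) :
    {T : StandardYoungTableau | T.shape = μ ∧ p T.word}.ncard = {w | (∀ i, w.count i = μ.rowLen i) ∧ p w}.ncard := by
  rw [← image_word μ p hp, word_injective.injOn.ncard_image]

end StandardYoungTableau

/-! ### Counting words of given content -/

theorem YoungDiagram.rowLen_eq_getD (μ : YoungDiagram) (i : ℕ) :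
    μ.rowLen i = μ.rowLens.getD i 0 := by
  by_cases hi : i < μ.rowLens.length
  · rw [List.getD_eq_getElem _ _ hi, YoungDiagram.get_rowLens]
  · rw [List.getD_eq_default _ _ (by omega)]
    rw [YoungDiagram.length_rowLens, ← YoungDiagram.mem_iff_lt_colLen,
      YoungDiagram.mem_iff_lt_rowLen] at hi
    omega

namespace RowWord

theorem count_primeGlue (t i : ℕ) (s : RowWord × RowWord × RowWord) :
    (primeGlue t s).count i = (glue t s).count i + [t + 1, t + 2].count i := by
  simp only [primeGlue, glue, List.count_append, List.count_cons, List.count_nil]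
  omega

theorem le_of_forall_count {w : RowWord} {n x : ℕ} (h : ∀ i, n < i → w.count i = 0)
    (hx : x ∈ w) : x ≤ n := by
  by_contra! hlt
  exact List.count_eq_zero.1 (h x hlt) hx

/-- If `f` describes a content with largest letter `t`, then the Richardson words of content `f` are
as many as the prime Richardson words with the additional letters `t + 1` and `t + 2`. -/
theorem ncard_isPrime_eq {t : ℕ} {f : ℕ → ℕ} (h0 : ∀ i, t < i → f i = 0) (ht : 0 < f t) :
    {w : RowWord | (∀ i, w.count i = f i + [t + 1, t + 2].count i) ∧
      w.IsRichardson ∧ w.IsPrime}.ncard =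
      {w : RowWord | (∀ i, w.count i = f i) ∧ w.IsRichardson}.ncard := by
  let S : Set (RowWord × RowWord × RowWord) :=
    {s | IsSplitting t s ∧ ∀ i, (glue t s).count i = f i}
  have hS : S ⊆ {s | IsSplitting t s} := fun s hs => hs.1
  have h1 : glue t '' S = {w : RowWord | (∀ i, w.count i = f i) ∧ w.IsRichardson} := by
    ext w
    constructor
    · rintro ⟨s, ⟨hs, hc⟩, rfl⟩
      exact ⟨hc, hs.isRichardson_glue⟩
    · rintro ⟨hc, hw⟩
      obtain ⟨s, hs, rfl⟩ := hw.exists_glue_eq (t := t)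
        (List.count_pos_iff.1 (by rwa [hc]))
        (fun x => le_of_forall_count fun i hi => by rw [hc, h0 i hi])
      exact ⟨s, ⟨hs, hc⟩, rfl⟩
  have h2 : primeGlue t '' S = {w : RowWord | (∀ i, w.count i = f i + [t + 1, t + 2].count i) ∧
      w.IsRichardson ∧ w.IsPrime} := by
    ext w
    constructor
    · rintro ⟨s, ⟨hs, hc⟩, rfl⟩
      exact ⟨fun i => by rw [count_primeGlue, hc], isRichardson_primeGlue hs.lt_left hs.le_right
        hs.rich_left hs.rich_mid hs.rich_right, hs.isPrime_primeGlue⟩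
    · rintro ⟨hc, hw, hp⟩
      obtain ⟨s, hs, rfl⟩ := hw.exists_primeGlue_eq (t := t) hp
        (by rw [hc, h0 _ (by omega)]; simp) (by rw [hc, h0 _ (by omega)]; simp)
        (fun x => le_of_forall_count fun i hi => by
          rw [hc, h0 i (by omega), zero_add, List.count_eq_zero]
          simp
          omega)
      refine ⟨s, ⟨hs, fun i => ?_⟩, rfl⟩
      have := hc i
      rw [count_primeGlue] at this
      omega
  rw [← h1, ← h2, ((glue_injOn t).mono hS).ncard_image,
    ((primeGlue_injOn t).mono hS).ncard_image]

theorem ncard_isPrime_count_zero_one :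
    {w : RowWord | (∀ i, w.count i = [0, 1].count i) ∧ w.IsRichardson ∧ w.IsPrime}.ncard = 1 := by
  have hY : ∀ a b : RowWord, [0, 1] = a ++ b → IsYamanouchi b → a = [] ∨ b = [] := by
    intro a b e hb
    rcases a with _ | ⟨x, _ | ⟨y, a⟩⟩
    · exact Or.inl rfl
    · simp only [List.cons_append, List.nil_append, List.cons.injEq] at e
      obtain ⟨-, rfl⟩ := e
      have := hb.count_le 0
      simp at this
    · simp only [List.cons_append, List.cons.injEq] at e
      exact Or.inr (List.append_eq_nil_iff.1 e.2.2.symm).2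
  rw [Set.ncard_eq_one]
  refine ⟨[0, 1], Set.eq_singleton_iff_unique_mem.2 ⟨⟨fun _ => rfl, ?_, by simp, ?_⟩, ?_⟩⟩
  · refine (isRichardson_nil.concat (r := 0) (by simp)).concat (r := 1) fun s hs => ?_
    obtain rfl : 0 = s := by omega
    exact ⟨[], [], rfl, by simp⟩
  · intro a b _ hb e
    exact hY a b e hb
  · rintro w ⟨hc, hw, -⟩
    have hperm : w.Perm [0, 1] := List.perm_iff_count.2 hc
    have hl := hperm.length_eq
    obtain ⟨x, y, rfl⟩ := List.length_eq_two.1 hl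
    -- The prefix of length 1 excludes the word `1 0`.
    have h0 := hw.isYamanouchi 1 0
    have c0 := hc 0
    have c1 := hc 1
    by_cases hx0 : x = 0 <;> by_cases hx1 : x = 1 <;> by_cases hy0 : y = 0 <;>
      by_cases hy1 : y = 1 <;> simp_all [List.count_cons]

theorem ncard_count_zero :
    {w : RowWord | (∀ i, w.count i = 0) ∧ w.IsRichardson}.ncard = 1 := by
  rw [Set.ncard_eq_one]
  refine ⟨[], Set.eq_singleton_iff_unique_mem.2 ⟨⟨by simp, isRichardson_nil⟩, ?_⟩⟩
  rintro w ⟨hc, -⟩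
  exact List.eq_nil_iff_forall_not_mem.2 fun x => List.count_eq_zero.1 (hc x)

end RowWord

theorem mainTheorem7 (lam mu : YoungDiagram) (h : lam.rowLens = mu.rowLens ++ [1, 1]) :
    {T : StandardYoungTableau | T.shape = lam ∧ T.IsRichardson ∧ T.IsPrime}.ncard =
      {T : StandardYoungTableau | T.shape = mu ∧ T.IsRichardson}.ncard := by
  have e1 := StandardYoungTableau.ncard_shape_eq lam (fun w => w.IsRichardson ∧ w.IsPrime)
    fun w hw => hw.1.isYamanouchi
  have e2 := StandardYoungTableau.ncard_shape_eq mu (fun w => w.IsRichardson)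
    fun w hw => hw.isYamanouchi
  simp only [StandardYoungTableau.isRichardson_word_iff,
    StandardYoungTableau.isPrime_word_iff] at e1 e2
  rw [e1, e2]
  -- Rows count from 0, so the two extra boxes lie in the rows indexed by the number of rows of `mu`
  -- and its successor.
  have hrow : ∀ i, lam.rowLen i = mu.rowLen i +
      [mu.rowLens.length, mu.rowLens.length + 1].count i := by
    intro i
    rw [lam.rowLen_eq_getD, mu.rowLen_eq_getD, h]
    rcases lt_or_ge i mu.rowLens.length with hi | hi
    · rw [List.getD_append _ _ _ _ hi, List.count_eq_zero.2 fun hi' => ?_, add_zero]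
      simp only [List.mem_cons, List.not_mem_nil, or_false] at hi'
      omega
    · obtain ⟨k, rfl⟩ := Nat.exists_eq_add_of_le hi
      rw [List.getD_append_right _ _ _ _ hi, List.getD_eq_default _ _ hi, zero_add,
        Nat.add_sub_cancel_left]
      rcases k with _ | _ | k <;> simp
  simp only [hrow]
  -- An empty `mu` has no largest letter to cut at; otherwise its last row has index `t` and the new
  -- letters are `t + 1` and `t + 2`.
  rcases hm : mu.rowLens.length with _ | t
  · have hz : ∀ i, mu.rowLen i = 0 := by
      intro i
      rw [mu.rowLen_eq_getD, List.getD_eq_default _ _ (by omega)]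
    simp only [hz, zero_add]
    rw [RowWord.ncard_isPrime_count_zero_one, RowWord.ncard_count_zero]
  · refine RowWord.ncard_isPrime_eq (fun i hi => ?_) ?_
    · rw [mu.rowLen_eq_getD, List.getD_eq_default _ _ (by omega)]
    · rw [← YoungDiagram.get_rowLens (h := by omega)]
      exact mu.pos_of_mem_rowLens _ (List.getElem_mem _)
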